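/- **Theorem 4.5.** For a 1-form $\theta$, use the normalisation $2\,d\theta(X,Y)=X\theta(Y)-Y\theta(X)-\theta([X,Y])$. Let $(M_1,J,g_1)$ be an almost Hermitian manifold (smooth, with $J^2=-\mathrm{id}$ and $g_1$ a Riemannian metric with $g_1(JX,JY)=g_1(X,Y)$), carrying a smooth 1-form $\omega$ with $d\omega(X,Y)=g_1(X,JY)$ for all $X,Y$. Let $(M_2,\phi,\xi,\eta,g_2)$ be a K-contact manifold, that is: $\phi^2V=-V+\eta(V)\xi$, $\eta(\xi)=1$, $g_2$ is a Riemannian metric with $g_2(\phi V,\phi W)=g_2(V,W)-\eta(V)\eta(W)$, $d\eta(V,W)=g_2(V,\phi W)$, and $\xi$ is a Killing vector field of $g_2$. Let $\alpha\in\mathbb R$ and let $f:M_1\to\mathbb R$ be a smooth positive function. Put $\bar\eta(X_1,X_2)=\alpha\,\omega(X_1)+\eta(X_2)$ and equip $M_1\times M_2$ with the warped product metric $$g\big((X_1,X_2),(Y_1,Y_2)\big)=g_1(X_1,Y_1)+f^2\big(g_2(X_2,Y_2)-\eta(X_2)\eta(Y_2)\big)+\bar\eta(X_1,X_2)\,\bar\eta(Y_1,Y_2).$$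 Let $I$ be an open interval, let $\gamma:I\to M_1$ and $\beta:I\to M_2$ be geodesics of $g_1$ and $g_2$, and put $X=\gamma'$, $V=\beta'$. Then the curve $(\gamma,\beta):I\to M_1\times M_2$ is a geodesic of $g$ if and only if the following two conditions hold along the curve, at every time in $I$: (i) $\;2\alpha\,\bar\eta(X,V)\,JX+f\,g_2(\phi V,\phi V)\,\mathrm{grad} f=0$; (ii) $\;-\dfrac{2X[f]}{f}\,\phi^2V+2\Big(-\dfrac1{f^2}\,\bar\eta(X,V)+\eta(V)\Big)\phi V+\alpha\Big(2\alpha\,\bar\eta(X,V)\,\omega(JX)+X\omega(X)+f\,g_2(\phi V,\phi V)\,\omega(\mathrm{grad} f)\Big)\xi=0.$ Here $\mathrm{grad} f$ is the gradient with respect to $g_1$, and $X\omega(X)$ is the derivative of the function $t\mapsto\omega(\gamma'(t))$. -/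

import Mathlib

open Set Bundle
open scoped Manifold ContDiff

noncomputable section WarpedContact

section Tensors

variable {E : Type*} [NormedAddCommGroup E] [NormedSpace ℝ E]
  {H : Type*} [TopologicalSpace H] (I : ModelWithCorners ℝ E H)
  {M : Type*} [TopologicalSpace M] [ChartedSpace H M]

/-- Pull-back of a bilinear form `b` along a linear map `L`: `(u, v) ↦ b (L u) (L v)`. -/
def bilinPullback {V W : Type*} [TopologicalSpace V] [AddCommGroup V] [Module ℝ V]
    [TopologicalSpace W] [AddCommGroup W] [Module ℝ W] [IsTopologicalAddGroup W]
    [IsTopologicalAddGroup V] [ContinuousSMul ℝ V] [ContinuousSMul ℝ W]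
    (b : W →L[ℝ] W →L[ℝ] ℝ) (L : V →L[ℝ] W) : V →L[ℝ] V →L[ℝ] ℝ :=
  (ContinuousLinearMap.precomp ℝ L).comp (b.comp L)

/-- The coordinate frame of the preferred chart at `p`: the derivative at `y` of the inverse chart,
sending the `i`-th basis vector of `E` to `∂/∂xᵢ`. -/
def coordFrame (p : M) (y : E) :
    E →L[ℝ] TangentSpace I ((extChartAt I p).symm y) :=
  mfderivWithin 𝓘(ℝ, E) I (extChartAt I p).symm (range I) y

/-- Coordinate expression, in the preferred chart at `p`, of a field of bilinear forms. -/
def chartMetric (g : ∀ x : M, TangentSpace I x →L[ℝ] TangentSpace I x →L[ℝ] ℝ) (p : M) (y : E) :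
    E →L[ℝ] E →L[ℝ] ℝ :=
  bilinPullback (g ((extChartAt I p).symm y)) (coordFrame I p y)

/-- Coordinate expression, in the preferred chart at `p`, of a 1-form. -/
def chartForm (ω₁ : ∀ x : M, TangentSpace I x →L[ℝ] ℝ) (p : M) (y : E) : E →L[ℝ] ℝ :=
  (ω₁ ((extChartAt I p).symm y)).comp (coordFrame I p y)

/-- Coordinate expression, in the preferred chart at `p`, of a vector field. -/
def chartField (ξ : ∀ x : M, TangentSpace I x) (p : M) (y : E) : E :=
  mfderiv I 𝓘(ℝ, E) (extChartAt I p) ((extChartAt I p).symm y) (ξ ((extChartAt I p).symm y))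

/-- The exterior derivative of a 1-form, with the normalisation
`2 dω₁(X, Y) = X ω₁(Y) - Y ω₁(X) - ω₁([X, Y])`, that is `dω₁(∂ᵢ, ∂ⱼ) = (∂ᵢ ωⱼ - ∂ⱼ ωᵢ) / 2` in
coordinates. It is evaluated at `x` in the preferred chart at `x`, whose coordinate frame at `x`
is the identity of `TangentSpace I x = E`. -/
def extDerivOneForm (ω₁ : ∀ x : M, TangentSpace I x →L[ℝ] ℝ) (x : M) (u v : E) : ℝ :=
  (1 / 2) * (fderiv ℝ (chartForm I ω₁ x) (extChartAt I x x) u v -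
    fderiv ℝ (chartForm I ω₁ x) (extChartAt I x x) v u)

/-- The Lie derivative `L_ξ g` of a field of bilinear forms, in coordinates:
`(L_ξ g)ᵢⱼ = ξᵏ ∂ₖ gᵢⱼ + gₖⱼ ∂ᵢ ξᵏ + gᵢₖ ∂ⱼ ξᵏ`. -/
def lieDerivMetric (g : ∀ x : M, TangentSpace I x →L[ℝ] TangentSpace I x →L[ℝ] ℝ)
    (ξ : ∀ x : M, TangentSpace I x) (x : M) (u v : E) : ℝ :=
  let y := extChartAt I x x
  let G := chartMetric I g x
  let Ξ := chartField I ξ x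
  fderiv ℝ G y (Ξ y) u v + G y (fderiv ℝ Ξ y u) v + G y u (fderiv ℝ Ξ y v)

/-- `ξ` is a Killing field of `g`. -/
def IsKilling (g : ∀ x : M, TangentSpace I x →L[ℝ] TangentSpace I x →L[ℝ] ℝ)
    (ξ : ∀ x : M, TangentSpace I x) : Prop :=
  ∀ (x : M) (u v : TangentSpace I x), lieDerivMetric I g ξ x u v = 0

/-- The gradient of `f`: the vector field with `g(grad f, Y) = Y[f]`. -/
def metricGradient (g : ∀ x : M, TangentSpace I x →L[ℝ] TangentSpace I x →L[ℝ] ℝ) (f : M → ℝ) (x : M) :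
    TangentSpace I x :=
  (g x).inverse (mfderiv I 𝓘(ℝ, ℝ) f x)

/-- The Christoffel symbols of the Levi-Civita connection of a metric `G` on the vector space `E`:
`Γᵏᵢⱼ = gᵏˡ (∂ᵢ gⱼₗ + ∂ⱼ gᵢₗ - ∂ₗ gᵢⱼ) / 2`. -/
def christoffel (G : E → E →L[ℝ] E →L[ℝ] ℝ) (y u v : E) : E :=
  (G y).inverse ((1 / 2 : ℝ) • (fderiv ℝ G y u v + fderiv ℝ G y v u -
    ((fderiv ℝ G y).flip u).flip v))

/-- The velocity `γ'(t)` of a curve. -/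
def velocity (γ : ℝ → M) (t : ℝ) : TangentSpace I (γ t) :=
  mfderiv 𝓘(ℝ, ℝ) I γ t (1 : ℝ)

/-- The covariant acceleration `∇_{γ'} γ'` at time `t` for the Levi-Civita connection of `g`:
`c'' + Γ(c', c')`, where `c` is the curve `γ` read in the preferred chart at `γ t`. -/
def covAccel (g : ∀ x : M, TangentSpace I x →L[ℝ] TangentSpace I x →L[ℝ] ℝ) (γ : ℝ → M) (t : ℝ) :
    TangentSpace I (γ t) :=
  let c : ℝ → E := fun s => extChartAt I (γ t) (γ s)
  (deriv (deriv c) t + christoffel (chartMetric I g (γ t)) (c t) (deriv c t) (deriv c t) : E)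

/-- The restriction of `γ` to the open set `s` of times is a smooth geodesic of `g`. -/
def IsGeodesicOn (g : ∀ x : M, TangentSpace I x →L[ℝ] TangentSpace I x →L[ℝ] ℝ) (γ : ℝ → M)
    (s : Set ℝ) : Prop :=
  ContMDiffOn 𝓘(ℝ, ℝ) I ∞ γ s ∧ ∀ t ∈ s, covAccel I g γ t = 0

variable [IsManifold I ∞ M]

/-- Smoothness of a 1-form. -/
def SmoothOneForm (ω₁ : ∀ x : M, TangentSpace I x →L[ℝ] ℝ) : Prop :=
  ContMDiff I (I.prod 𝓘(ℝ, E →L[ℝ] ℝ)) ∞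
    (fun x : M => (TotalSpace.mk' (E →L[ℝ] ℝ) x (ω₁ x) :
      TotalSpace (E →L[ℝ] ℝ) (fun x : M => TangentSpace I x →L[ℝ] ℝ)))

/-- Smoothness of a (1,1)-tensor field. -/
def SmoothEndo (A : ∀ x : M, TangentSpace I x →L[ℝ] TangentSpace I x) : Prop :=
  ContMDiff I (I.prod 𝓘(ℝ, E →L[ℝ] E)) ∞
    (fun x : M => (TotalSpace.mk' (E →L[ℝ] E) x (A x) :
      TotalSpace (E →L[ℝ] E) (fun x : M => TangentSpace I x →L[ℝ] TangentSpace I x)))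

/-- Smoothness of a vector field. -/
def SmoothField (ξ : ∀ x : M, TangentSpace I x) : Prop :=
  ContMDiff I I.tangent ∞ (fun x : M => (⟨x, ξ x⟩ : TangentBundle I M))

/-- `(M, J, g)` is an almost Hermitian manifold. -/
structure IsAlmostHermitian (J : ∀ x : M, TangentSpace I x →L[ℝ] TangentSpace I x)
    (g : ContMDiffRiemannianMetric I ∞ E (fun x : M => TangentSpace I x)) : Prop where
  smooth_J : SmoothEndo I J
  J_sq : ∀ (x : M) (u : TangentSpace I x), J x (J x u) = -u
  compat : ∀ (x : M) (u v : TangentSpace I x), g.inner x (J x u) (J x v) = g.inner x u v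

/-- `(M, φ, ξ, η, g)` is an almost contact metric manifold. -/
structure IsAlmostContactMetric (φ : ∀ x : M, TangentSpace I x →L[ℝ] TangentSpace I x)
    (ξ : ∀ x : M, TangentSpace I x) (η : ∀ x : M, TangentSpace I x →L[ℝ] ℝ)
    (g : ContMDiffRiemannianMetric I ∞ E (fun x : M => TangentSpace I x)) : Prop where
  smooth_φ : SmoothEndo I φ
  smooth_ξ : SmoothField I ξ
  smooth_η : SmoothOneForm I η
  φ_sq : ∀ (x : M) (u : TangentSpace I x), φ x (φ x u) = -u + η x u • ξ x
  η_ξ : ∀ x : M, η x (ξ x) = 1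
  compat : ∀ (x : M) (u v : TangentSpace I x),
    g.inner x (φ x u) (φ x v) = g.inner x u v - η x u * η x v

/-- `(M, φ, ξ, η, g)` is a contact metric manifold: `dη(X, Y) = g(X, φ Y)`. -/
structure IsContactMetric (φ : ∀ x : M, TangentSpace I x →L[ℝ] TangentSpace I x)
    (ξ : ∀ x : M, TangentSpace I x) (η : ∀ x : M, TangentSpace I x →L[ℝ] ℝ)
    (g : ContMDiffRiemannianMetric I ∞ E (fun x : M => TangentSpace I x)) : Prop
    extends IsAlmostContactMetric I φ ξ η g where
  d_η : ∀ (x : M) (u v : TangentSpace I x), extDerivOneForm I η x u v = g.inner x u (φ x v)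

/-- `(M, φ, ξ, η, g)` is a K-contact manifold: a contact metric manifold whose characteristic
vector field `ξ` is a Killing field. -/
structure IsKContact (φ : ∀ x : M, TangentSpace I x →L[ℝ] TangentSpace I x)
    (ξ : ∀ x : M, TangentSpace I x) (η : ∀ x : M, TangentSpace I x →L[ℝ] ℝ)
    (g : ContMDiffRiemannianMetric I ∞ E (fun x : M => TangentSpace I x)) : Prop
    extends IsContactMetric I φ ξ η g where
  killing : IsKilling I g.inner ξ

end Tensors

section Product

variable {E₁ : Type*} [NormedAddCommGroup E₁] [NormedSpace ℝ E₁]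
  {H₁ : Type*} [TopologicalSpace H₁] (I₁ : ModelWithCorners ℝ E₁ H₁)
  {M₁ : Type*} [TopologicalSpace M₁] [ChartedSpace H₁ M₁]
  {E₂ : Type*} [NormedAddCommGroup E₂] [NormedSpace ℝ E₂]
  {H₂ : Type*} [TopologicalSpace H₂] (I₂ : ModelWithCorners ℝ E₂ H₂)
  {M₂ : Type*} [TopologicalSpace M₂] [ChartedSpace H₂ M₂]

/-- The projection `T_p(M₁ × M₂) → T_{p₁}M₁`. -/
def tangentFst (p : M₁ × M₂) : TangentSpace (I₁.prod I₂) p →L[ℝ] TangentSpace I₁ p.1 :=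
  ContinuousLinearMap.fst ℝ (TangentSpace I₁ p.1) (TangentSpace I₂ p.2)

/-- The projection `T_p(M₁ × M₂) → T_{p₂}M₂`. -/
def tangentSnd (p : M₁ × M₂) : TangentSpace (I₁.prod I₂) p →L[ℝ] TangentSpace I₂ p.2 :=
  ContinuousLinearMap.snd ℝ (TangentSpace I₁ p.1) (TangentSpace I₂ p.2)

/-- The 1-form `η̄(X₁, X₂) = a ω(X₁) + η(X₂)` on `M₁ × M₂`. -/
def etaBar (a : ℝ) (ω₁ : ∀ x : M₁, TangentSpace I₁ x →L[ℝ] ℝ)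
    (η : ∀ x : M₂, TangentSpace I₂ x →L[ℝ] ℝ) (p : M₁ × M₂) :
    TangentSpace (I₁.prod I₂) p →L[ℝ] ℝ :=
  a • (ω₁ p.1).comp (tangentFst I₁ I₂ p) + (η p.2).comp (tangentSnd I₁ I₂ p)

/-- The warped product metric `g = g₁ + f² (g₂ - η ⊗ η) + η̄ ⊗ η̄` on `M₁ × M₂`. -/
def warpedMetric (a : ℝ) (f : M₁ → ℝ)
    (g₁ : ∀ x : M₁, TangentSpace I₁ x →L[ℝ] TangentSpace I₁ x →L[ℝ] ℝ)
    (ω₁ : ∀ x : M₁, TangentSpace I₁ x →L[ℝ] ℝ)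
    (g₂ : ∀ x : M₂, TangentSpace I₂ x →L[ℝ] TangentSpace I₂ x →L[ℝ] ℝ)
    (η : ∀ x : M₂, TangentSpace I₂ x →L[ℝ] ℝ) (p : M₁ × M₂) :
    TangentSpace (I₁.prod I₂) p →L[ℝ] TangentSpace (I₁.prod I₂) p →L[ℝ] ℝ :=
  bilinPullback (g₁ p.1) (tangentFst I₁ I₂ p) +
    f p.1 ^ 2 • bilinPullback (g₂ p.2 - (η p.2).smulRight (η p.2)) (tangentSnd I₁ I₂ p) +
    (etaBar I₁ I₂ a ω₁ η p).smulRight (etaBar I₁ I₂ a ω₁ η p)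

end Product

end WarpedContact

/-! ### Coordinate expressions of smooth tensors are differentiable at the centre of the chart. -/

section ChartRegularity

open Filter Topology

variable {E : Type*} [NormedAddCommGroup E] [NormedSpace ℝ E]
  {M : Type*} [TopologicalSpace M] [ChartedSpace E M] [IsManifold 𝓘(ℝ, E) ∞ M]

/-! Paired with an arbitrary vector `w`, the geodesic equation becomes the Euler-Lagrange equation
`G(A, w) + (D_u G)(u, w) - (D_w G)(u, u) / 2 = 0`, which involves no inverse metric
(`add_christoffel_eq_zero_iff`). In a product chart the warped metric is an explicit expression in
`G₁`, `G₂`, `ω`, `η`, `f`, so the equation can be expanded by the product rule.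

From the expansion one subtracts the equation of `γ` tested on `w₁`, `f²` times that of `β` tested
on `w₂`, and a multiple of the derivative of `η(V)`. The last vanishes by Noether's argument: `η(V)
= g₂(ξ, V)` and `ξ` is Killing. All second derivatives of `β` disappear, and those of `γ` survive
only in `Xω(X)`. The antisymmetrised derivatives of `ω` and `η` are `2dω` and `2dη`, hence `2g₁(·,
J·)` and `2g₂(·, φ·)` (`add_christoffel_warped_eq_zero_iff`).

What remains is linear algebra at one point (`warped_variational_iff`). Testing on `(0, ξ)` gives `α
Xω(X) = 0`. Then the `w₁` and `w₂` parts decouple, and nondegeneracy of `g₁` and `g₂` turns them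
into (i) and (ii). Conversely, `ω` applied to (i) and `η` applied to (ii) give back `α Xω(X) = 0`:
modulo (i), the `ξ`-coefficient in (ii) is just this quantity.

Everything is computed in the preferred chart at the point, where the coordinate frame is the
identity. -/

theorem contMDiffAt_extChartAt_symm_center (p : M) :
    ContMDiffAt 𝓘(ℝ, E) 𝓘(ℝ, E) ∞ (extChartAt 𝓘(ℝ, E) p).symm (extChartAt 𝓘(ℝ, E) p p) :=
  (contMDiffOn_extChartAt_symm p).contMDiffAt (extChartAt_target_mem_nhds p)

/-- Bridge between smoothness of sections, which is defined through bundle trivialisations, and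
chart expressions, which are defined through `coordFrame`. -/
theorem symmL_trivializationAt_eq_coordFrame {p : M} {y : E}
    (hy : y ∈ (extChartAt 𝓘(ℝ, E) p).target) :
    Trivialization.symmL ℝ (trivializationAt E (TangentSpace 𝓘(ℝ, E)) p)
      ((extChartAt 𝓘(ℝ, E) p).symm y) = coordFrame 𝓘(ℝ, E) p y := by
  have : IsManifold 𝓘(ℝ, E) 1 M := IsManifold.of_le (n := ∞) (by simp)
  have hs : (extChartAt 𝓘(ℝ, E) p).symm y ∈ (chartAt E p).source := by
    simpa [extChartAt_source] using (extChartAt 𝓘(ℝ, E) p).map_target hy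
  rw [TangentBundle.symmL_trivializationAt hs, (extChartAt 𝓘(ℝ, E) p).right_inv hy]
  rfl

/-- Composition with the inverse chart turns smoothness at `p` into differentiability. -/
theorem ContMDiffAt.differentiableAt_comp_extChartAt_symm {F : Type*} [NormedAddCommGroup F]
    [NormedSpace ℝ F] {h : M → F} {p : M} (hh : ContMDiffAt 𝓘(ℝ, E) 𝓘(ℝ, F) ∞ h p) :
    DifferentiableAt ℝ (fun y => h ((extChartAt 𝓘(ℝ, E) p).symm y)) (extChartAt 𝓘(ℝ, E) p p) := by
  have h1 : ContMDiffAt 𝓘(ℝ, E) 𝓘(ℝ, F) ∞ h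
      ((extChartAt 𝓘(ℝ, E) p).symm (extChartAt 𝓘(ℝ, E) p p)) := by
    rwa [extChartAt_to_inv]
  have h2 := h1.comp _ (contMDiffAt_extChartAt_symm_center p)
  exact (contMDiffAt_iff_contDiffAt.1 h2).differentiableAt (by simp)

theorem differentiableAt_chartForm {ω₁ : ∀ x : M, TangentSpace 𝓘(ℝ, E) x →L[ℝ] ℝ}
    (hω : SmoothOneForm 𝓘(ℝ, E) ω₁) (p : M) :
    DifferentiableAt ℝ (chartForm 𝓘(ℝ, E) ω₁ p) (extChartAt 𝓘(ℝ, E) p p) := by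
  have h := ((contMDiffAt_hom_bundle (E₁ := fun x : M => TangentSpace 𝓘(ℝ, E) x)
    (E₂ := fun _ : M => ℝ) _).1 (hω p)).2.differentiableAt_comp_extChartAt_symm
  refine h.congr_of_eventuallyEq ?_
  filter_upwards [extChartAt_target_mem_nhds (I := 𝓘(ℝ, E)) p] with y hy
  simp only [ContinuousLinearMap.inCoordinates]
  rw [symmL_trivializationAt_eq_coordFrame hy]
  ext v
  simp [chartForm]

theorem differentiableAt_chartField {ξ : ∀ x : M, TangentSpace 𝓘(ℝ, E) x}
    (hξ : SmoothField 𝓘(ℝ, E) ξ) (p : M) :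
    DifferentiableAt ℝ (chartField 𝓘(ℝ, E) ξ p) (extChartAt 𝓘(ℝ, E) p p) := by
  have : IsManifold 𝓘(ℝ, E) 1 M := IsManifold.of_le (n := ∞) (by simp)
  have h := ((contMDiffAt_section (E := fun x : M => TangentSpace 𝓘(ℝ, E) x) p).1
    (hξ p)).differentiableAt_comp_extChartAt_symm
  refine h.congr_of_eventuallyEq ?_
  filter_upwards [extChartAt_target_mem_nhds (I := 𝓘(ℝ, E)) p] with y hy
  have hs : (extChartAt 𝓘(ℝ, E) p).symm y ∈ (chartAt E p).source := by
    simpa [extChartAt_source] using (extChartAt 𝓘(ℝ, E) p).map_target hy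
  have hb : (extChartAt 𝓘(ℝ, E) p).symm y ∈
      (trivializationAt E (TangentSpace 𝓘(ℝ, E)) p).baseSet := hs
  exact (DFunLike.congr_fun (TangentBundle.continuousLinearMapAt_trivializationAt hs) _).symm.trans
    (congrFun (Trivialization.coe_linearMapAt_of_mem _ hb) _)

theorem differentiableAt_chartMetric
    (g : ContMDiffRiemannianMetric 𝓘(ℝ, E) ∞ E (fun x : M => TangentSpace 𝓘(ℝ, E) x)) (p : M) :
    DifferentiableAt ℝ (chartMetric 𝓘(ℝ, E) g.inner p) (extChartAt 𝓘(ℝ, E) p p) := by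
  have h := ((contMDiffAt_hom_bundle (E₁ := fun x : M => TangentSpace 𝓘(ℝ, E) x)
    (E₂ := fun x : M => TangentSpace 𝓘(ℝ, E) x →L[ℝ] ℝ) _).1
    (g.contMDiff p)).2.differentiableAt_comp_extChartAt_symm
  refine h.congr_of_eventuallyEq ?_
  filter_upwards [extChartAt_target_mem_nhds (I := 𝓘(ℝ, E)) p] with y hy
  have hs : (extChartAt 𝓘(ℝ, E) p).symm y ∈ (chartAt E p).source := by
    simpa [extChartAt_source] using (extChartAt 𝓘(ℝ, E) p).map_target hy
  ext u v
  refine Eq.trans ?_ (inCoordinates_apply_eq₂ (E₁ := fun x : M => TangentSpace 𝓘(ℝ, E) x)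
    (E₂ := fun x : M => TangentSpace 𝓘(ℝ, E) x) (E₃ := fun _ : M => ℝ) hs hs (mem_univ _)).symm
  have e (w : E) : (trivializationAt E (fun x : M => TangentSpace 𝓘(ℝ, E) x) p).symm
      ((extChartAt 𝓘(ℝ, E) p).symm y) w = coordFrame 𝓘(ℝ, E) p y w := by
    rw [← symmL_trivializationAt_eq_coordFrame hy, Trivialization.symmL_apply]
    exact hs
  rw [e u, e v]
  simp
  rfl

theorem coordFrame_comp_mfderiv_extChartAt {p : M} {y : E}
    (hy : y ∈ (extChartAt 𝓘(ℝ, E) p).target)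
    (v : TangentSpace 𝓘(ℝ, E) ((extChartAt 𝓘(ℝ, E) p).symm y)) :
    coordFrame 𝓘(ℝ, E) p y (mfderiv 𝓘(ℝ, E) 𝓘(ℝ, E) (extChartAt 𝓘(ℝ, E) p)
      ((extChartAt 𝓘(ℝ, E) p).symm y) v) = v := by
  have : IsManifold 𝓘(ℝ, E) 1 M := IsManifold.of_le (n := ∞) (by simp)
  have hs : (extChartAt 𝓘(ℝ, E) p).symm y ∈ (chartAt E p).source := by
    simpa [extChartAt_source] using (extChartAt 𝓘(ℝ, E) p).map_target hy
  rw [← symmL_trivializationAt_eq_coordFrame hy,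
    ← TangentBundle.continuousLinearMapAt_trivializationAt hs]
  exact Trivialization.symmL_continuousLinearMapAt _ hs v

/-- `coordFrame`, with values in the model space. -/
noncomputable def coordFrameModel {E : Type*} [NormedAddCommGroup E] [NormedSpace ℝ E]
    {H : Type*} [TopologicalSpace H] (I : ModelWithCorners ℝ E H)
    {M : Type*} [TopologicalSpace M] [ChartedSpace H M] (p : M) (y : E) : E →L[ℝ] E :=
  coordFrame I p y

/-- The coordinate frame, as the derivative of a transition map. -/
theorem hasFDerivAt_transition {E : Type*} [NormedAddCommGroup E] [NormedSpace ℝ E]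
    {H : Type*} [TopologicalSpace H] {I : ModelWithCorners ℝ E H} [I.Boundaryless]
    {M : Type*} [TopologicalSpace M] [ChartedSpace H M] [IsManifold I ∞ M]
    {p : M} {y : E} (hy : y ∈ (extChartAt I p).target) :
    HasFDerivAt (fun z => extChartAt I ((extChartAt I p).symm y)
      ((extChartAt I p).symm z)) (coordFrameModel I p y) y := by
  have h : MDifferentiableAt 𝓘(ℝ, E) I (extChartAt I p).symm y :=
    ((contMDiffOn_extChartAt_symm (n := ∞) p).contMDiffAt
      (extChartAt_target_mem_nhds' hy)).mdifferentiableAt (by simp)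
  have e : coordFrame I p y = mfderiv 𝓘(ℝ, E) I (extChartAt I p).symm y := by
    rw [coordFrame, I.range_eq_univ, mfderivWithin_univ]
  have h2 : HasFDerivWithinAt (fun z => extChartAt I ((extChartAt I p).symm y)
      ((extChartAt I p).symm z)) (coordFrameModel I p y) (range id) y := by
    rw [coordFrameModel, e]
    exact h.hasMFDerivAt.2
  rw [range_id] at h2
  exact hasFDerivWithinAt_univ.1 h2

theorem coordFrame_center (p : M) (v : E) :
    coordFrame 𝓘(ℝ, E) p (extChartAt 𝓘(ℝ, E) p p) v = v := by
  have h := hasFDerivAt_transition (p := p) (mem_extChartAt_target (I := 𝓘(ℝ, E)) p)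
  -- At the centre, the transition map is from the preferred chart to itself, hence the identity
  -- near the point.
  simp only [extChartAt_to_inv] at h
  have h2 : HasFDerivAt (fun z => extChartAt 𝓘(ℝ, E) p ((extChartAt 𝓘(ℝ, E) p).symm z))
      (ContinuousLinearMap.id ℝ E) (extChartAt 𝓘(ℝ, E) p p) := by
    refine (hasFDerivAt_id _).congr_of_eventuallyEq ?_
    filter_upwards [extChartAt_target_mem_nhds (I := 𝓘(ℝ, E)) p] with y hy
    exact (extChartAt 𝓘(ℝ, E) p).right_inv hy
  have e : coordFrameModel 𝓘(ℝ, E) p (extChartAt 𝓘(ℝ, E) p p) =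
      ContinuousLinearMap.id ℝ E := h.unique h2
  exact congrArg (fun L : E →L[ℝ] E => (L v : E)) e

end ChartRegularity

/-! ### The geodesic equation on a vector space. -/

section Flat

variable {E : Type*} [NormedAddCommGroup E] [NormedSpace ℝ E]

/-- Injectivity from positivity, then equality of dimensions. Without invertibility
`ContinuousLinearMap.inverse` takes the default value `0`, and `christoffel` and `metricGradient`
lose their meaning. -/
theorem ContinuousLinearMap.isInvertible_of_posDef [FiniteDimensional ℝ E] {b : E →L[ℝ] E →L[ℝ] ℝ}
    (hb : ∀ v, v ≠ 0 → 0 < b v v) : b.IsInvertible := by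
  have hinj : Function.Injective (b : E →ₗ[ℝ] E →L[ℝ] ℝ) := by
    rw [← LinearMap.ker_eq_bot, LinearMap.ker_eq_bot']
    intro v hv
    by_contra h
    have h1 := hb v h
    have h2 : b v = 0 := hv
    simp [h2] at h1
  have hdim : Module.finrank ℝ E = Module.finrank ℝ (E →L[ℝ] ℝ) := by
    rw [← (LinearMap.toContinuousLinearMap (𝕜 := ℝ) (E := E) (F' := ℝ)).finrank_eq]
    exact (Subspace.dual_finrank_eq (K := ℝ) (V := E)).symm
  exact ⟨(LinearEquiv.ofInjectiveOfFinrankEq (b : E →ₗ[ℝ] E →L[ℝ] ℝ) hinj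
    hdim).toContinuousLinearEquiv, by ext; rfl⟩

/-- The geodesic equation at one time, tested against all vectors. -/
theorem add_christoffel_eq_zero_iff {G : E → E →L[ℝ] E →L[ℝ] ℝ} {y : E}
    (hG : (G y).IsInvertible) (A u : E) :
    A + christoffel G y u u = 0 ↔
      ∀ w, G y A w + fderiv ℝ G y u u w - 1 / 2 * fderiv ℝ G y w u u = 0 := by
  obtain ⟨e, he⟩ := hG
  have h1 : A + christoffel G y u u = 0 ↔ G y (A + christoffel G y u u) = 0 := by
    rw [← he, ContinuousLinearEquiv.coe_coe, EmbeddingLike.map_eq_zero_iff]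
  rw [h1, christoffel, map_add, ← he, ContinuousLinearMap.inverse_equiv]
  simp only [ContinuousLinearEquiv.coe_coe, ContinuousLinearEquiv.apply_symm_apply]
  rw [ContinuousLinearMap.ext_iff]
  refine forall_congr' fun w => ?_
  simp only [add_apply, smul_apply,
    sub_apply, ContinuousLinearMap.flip_apply, smul_eq_mul,
    zero_apply]
  constructor <;> intro h <;> linarith

theorem DifferentiableAt.hasFDerivAt_bilin_apply {G : E → E →L[ℝ] E →L[ℝ] ℝ} {y : E}
    (hG : DifferentiableAt ℝ G y) (u v : E) :
    HasFDerivAt (fun z => G z u v) (((fderiv ℝ G y).flip u).flip v) y := by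
  have h := (hG.hasFDerivAt.clm_apply (hasFDerivAt_const u y)).clm_apply (hasFDerivAt_const v y)
  refine h.congr_fderiv ?_
  ext w
  simp

theorem DifferentiableAt.hasFDerivAt_form_apply {Θ : E → E →L[ℝ] ℝ} {y : E}
    (hΘ : DifferentiableAt ℝ Θ y) (u : E) :
    HasFDerivAt (fun z => Θ z u) ((fderiv ℝ Θ y).flip u) y := by
  have h := hΘ.hasFDerivAt.clm_apply (hasFDerivAt_const u y)
  refine h.congr_fderiv ?_
  ext w
  simp

/-- Expansion in a finite basis. The warped metric is known only through its values on pairs of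
vectors; applied twice, this recovers its differentiability as a map into bilinear forms. -/
theorem differentiableAt_of_clm_apply {D F : Type*} [NormedAddCommGroup D] [NormedSpace ℝ D]
    [NormedAddCommGroup F] [NormedSpace ℝ F] [FiniteDimensional ℝ E] {f : D → E →L[ℝ] F} {y : D}
    (h : ∀ v, DifferentiableAt ℝ (fun z => f z v) y) : DifferentiableAt ℝ f y := by
  let b := Module.finBasis ℝ E
  have key : f = fun z => ∑ i, ContinuousLinearMap.smulRightL ℝ E F
      (LinearMap.toContinuousLinearMap (b.coord i)) (f z (b i)) := by
    funext z
    refine ContinuousLinearMap.coe_injective (b.ext fun j => ?_)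
    simp [ContinuousLinearMap.smulRightL, Finsupp.single_apply]
  rw [key]
  exact DifferentiableAt.fun_sum fun i _ =>
    (ContinuousLinearMap.differentiableAt _).comp y (h (b i))

variable {E₁ : Type*} [NormedAddCommGroup E₁] [NormedSpace ℝ E₁]
  {E₂ : Type*} [NormedAddCommGroup E₂] [NormedSpace ℝ E₂]

/-- The value at `(u, v)` of the warped product metric on a product of vector spaces. -/
noncomputable def warpedForm (a : ℝ) (F : E₁ → ℝ) (G₁ : E₁ → E₁ →L[ℝ] E₁ →L[ℝ] ℝ) (Ω : E₁ → E₁ →L[ℝ] ℝ)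
    (G₂ : E₂ → E₂ →L[ℝ] E₂ →L[ℝ] ℝ) (Θ : E₂ → E₂ →L[ℝ] ℝ) (u v z : E₁ × E₂) : ℝ :=
  G₁ z.1 u.1 v.1 + F z.1 ^ 2 * (G₂ z.2 u.2 v.2 - Θ z.2 u.2 * Θ z.2 v.2) +
    (a * Ω z.1 u.1 + Θ z.2 u.2) * (a * Ω z.1 v.1 + Θ z.2 v.2)

variable {a : ℝ} {F : E₁ → ℝ} {G₁ : E₁ → E₁ →L[ℝ] E₁ →L[ℝ] ℝ} {Ω : E₁ → E₁ →L[ℝ] ℝ}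
  {G₂ : E₂ → E₂ →L[ℝ] E₂ →L[ℝ] ℝ} {Θ : E₂ → E₂ →L[ℝ] ℝ} {y : E₁ × E₂}

theorem hasFDerivAt_warpedForm (hF : DifferentiableAt ℝ F y.1) (hG₁ : DifferentiableAt ℝ G₁ y.1)
    (hΩ : DifferentiableAt ℝ Ω y.1) (hG₂ : DifferentiableAt ℝ G₂ y.2)
    (hΘ : DifferentiableAt ℝ Θ y.2) (u v : E₁ × E₂) :
    ∃ L : E₁ × E₂ →L[ℝ] ℝ, HasFDerivAt (warpedForm a F G₁ Ω G₂ Θ u v) L y ∧ ∀ w, L w =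
      fderiv ℝ G₁ y.1 w.1 u.1 v.1 +
      2 * F y.1 * fderiv ℝ F y.1 w.1 * (G₂ y.2 u.2 v.2 - Θ y.2 u.2 * Θ y.2 v.2) +
      F y.1 ^ 2 * (fderiv ℝ G₂ y.2 w.2 u.2 v.2 - fderiv ℝ Θ y.2 w.2 u.2 * Θ y.2 v.2 -
        Θ y.2 u.2 * fderiv ℝ Θ y.2 w.2 v.2) +
      (a * fderiv ℝ Ω y.1 w.1 u.1 + fderiv ℝ Θ y.2 w.2 u.2) * (a * Ω y.1 v.1 + Θ y.2 v.2) +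
      (a * Ω y.1 u.1 + Θ y.2 u.2) * (a * fderiv ℝ Ω y.1 w.1 v.1 + fderiv ℝ Θ y.2 w.2 v.2) := by
  have d1 := (hG₁.hasFDerivAt_bilin_apply u.1 v.1).comp y hasFDerivAt_fst
  have dF := hF.hasFDerivAt.comp y hasFDerivAt_fst
  have d2 := (hG₂.hasFDerivAt_bilin_apply u.2 v.2).comp y hasFDerivAt_snd
  have dΩu := (hΩ.hasFDerivAt_form_apply u.1).comp y hasFDerivAt_fst
  have dΩv := (hΩ.hasFDerivAt_form_apply v.1).comp y hasFDerivAt_fst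
  have dΘu := (hΘ.hasFDerivAt_form_apply u.2).comp y hasFDerivAt_snd
  have dΘv := (hΘ.hasFDerivAt_form_apply v.2).comp y hasFDerivAt_snd
  refine ⟨_, (d1.add ((dF.pow 2).mul (d2.sub (dΘu.mul dΘv)))).add
    (((dΩu.const_mul a).add dΘu).mul ((dΩv.const_mul a).add dΘv)), fun w => ?_⟩
  simp
  ring

/-- The covariant acceleration of the warped product metric, for a pair of geodesics. -/
theorem add_christoffel_warped_eq_zero_iff [FiniteDimensional ℝ E₁] [FiniteDimensional ℝ E₂]
    {G : E₁ × E₂ → E₁ × E₂ →L[ℝ] E₁ × E₂ →L[ℝ] ℝ}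
    (hG : ∀ᶠ z in nhds y, ∀ u v, G z u v = warpedForm a F G₁ Ω G₂ Θ u v z)
    (hGi : (G y).IsInvertible) (hG₁i : (G₁ y.1).IsInvertible) (hG₂i : (G₂ y.2).IsInvertible)
    (hF : DifferentiableAt ℝ F y.1) (hG₁ : DifferentiableAt ℝ G₁ y.1)
    (hΩ : DifferentiableAt ℝ Ω y.1) (hG₂ : DifferentiableAt ℝ G₂ y.2)
    (hΘ : DifferentiableAt ℝ Θ y.2) (A u : E₁ × E₂)
    (h₁ : A.1 + christoffel G₁ y.1 u.1 u.1 = 0) (h₂ : A.2 + christoffel G₂ y.2 u.2 u.2 = 0)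
    (hΘu : fderiv ℝ Θ y.2 u.2 u.2 + Θ y.2 A.2 = 0) :
    A + christoffel G y u u = 0 ↔ ∀ w₁ w₂,
      (a * Ω y.1 u.1 + Θ y.2 u.2) * (a * (fderiv ℝ Ω y.1 u.1 w₁ - fderiv ℝ Ω y.1 w₁ u.1) +
        (fderiv ℝ Θ y.2 u.2 w₂ - fderiv ℝ Θ y.2 w₂ u.2)) -
      F y.1 ^ 2 * Θ y.2 u.2 * (fderiv ℝ Θ y.2 u.2 w₂ - fderiv ℝ Θ y.2 w₂ u.2) +
      2 * F y.1 * fderiv ℝ F y.1 u.1 * (G₂ y.2 u.2 w₂ - Θ y.2 u.2 * Θ y.2 w₂) -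
      F y.1 * fderiv ℝ F y.1 w₁ * (G₂ y.2 u.2 u.2 - Θ y.2 u.2 * Θ y.2 u.2) +
      a * (fderiv ℝ Ω y.1 u.1 u.1 + Ω y.1 A.1) * (a * Ω y.1 w₁ + Θ y.2 w₂) = 0 := by
  have hGd (u v : E₁ × E₂) : HasFDerivAt (fun z => G z u v)
      (hasFDerivAt_warpedForm (a := a) hF hG₁ hΩ hG₂ hΘ u v).choose y :=
    (hasFDerivAt_warpedForm (a := a) hF hG₁ hΩ hG₂ hΘ u v).choose_spec.1.congr_of_eventuallyEq
      (hG.mono fun z hz => hz u v)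
  have hGdiff : DifferentiableAt ℝ G y := differentiableAt_of_clm_apply fun u =>
    differentiableAt_of_clm_apply fun v => (hGd u v).differentiableAt
  have hfd (w u v : E₁ × E₂) := (DFunLike.congr_fun
    ((hGdiff.hasFDerivAt_bilin_apply u v).unique (hGd u v)) w).trans
    ((hasFDerivAt_warpedForm (a := a) hF hG₁ hΩ hG₂ hΘ u v).choose_spec.2 w)
  simp only [ContinuousLinearMap.flip_apply] at hfd
  rw [add_christoffel_eq_zero_iff hG₁i] at h₁
  rw [add_christoffel_eq_zero_iff hG₂i] at h₂
  rw [add_christoffel_eq_zero_iff hGi, Prod.forall]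
  refine forall₂_congr fun w₁ w₂ => ?_
  rw [hfd, hfd, hG.self_of_nhds, warpedForm]
  refine Eq.congr_left ?_
  -- The sum `D_u Θ(u) + Θ(A)` enters through `η̄ ⊗ η̄` with factor `η̄(w)` and through `-f² η ⊗ η`
  -- with factor `-f² η(w₂)`. The analogous sum for `Ω` is not conserved and stays as the last term.
  linear_combination h₁ w₁ + F y.1 ^ 2 * h₂ w₂ +
    (a * Ω y.1 w₁ + Θ y.2 w₂ - F y.1 ^ 2 * Θ y.2 w₂) * hΘu

/-- Along a geodesic, the product of the velocity with a Killing field is constant. -/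
theorem fderiv_add_eq_zero_of_killing {G : E → E →L[ℝ] E →L[ℝ] ℝ} {Θ : E → E →L[ℝ] ℝ} {Ξ : E → E}
    {y A u : E} (hGi : (G y).IsInvertible) (hG : DifferentiableAt ℝ G y)
    (hΞ : DifferentiableAt ℝ Ξ y) (hsymm : ∀ᶠ z in nhds y, ∀ v w, G z v w = G z w v)
    (hΘ : ∀ᶠ z in nhds y, Θ z = G z (Ξ z))
    (hkill : fderiv ℝ G y (Ξ y) u u + G y (fderiv ℝ Ξ y u) u + G y u (fderiv ℝ Ξ y u) = 0)
    (h : A + christoffel G y u u = 0) : fderiv ℝ Θ y u u + Θ y A = 0 := by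
  have hs (w v v' : E) : fderiv ℝ G y w v v' = fderiv ℝ G y w v' v := by
    have h1 := (hG.hasFDerivAt_bilin_apply v v').unique
      ((hG.hasFDerivAt_bilin_apply v' v).congr_of_eventuallyEq (hsymm.mono fun z hz => hz v v'))
    simpa using DFunLike.congr_fun h1 w
  have hd : fderiv ℝ Θ y u u = fderiv ℝ G y u (Ξ y) u + G y (fderiv ℝ Ξ y u) u := by
    rw [Filter.EventuallyEq.fderiv_eq hΘ, fderiv_clm_apply hG hΞ]
    simp [add_comm]
  rw [add_christoffel_eq_zero_iff hGi] at h
  -- Noether's argument: the Euler-Lagrange equation is tested on the Killing field itself, and the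
  -- Killing equation on `(u, u)` replaces `D_Ξ G(u, u) / 2` by `-G(D_u Ξ, u)`.
  have h1 := h (Ξ y)
  rw [hd, hΘ.self_of_nhds]
  linear_combination h1 + 1 / 2 * hkill + hs u (Ξ y) u + hsymm.self_of_nhds (Ξ y) A
    + 1 / 2 * hsymm.self_of_nhds (fderiv ℝ Ξ y u) u

end Flat

/-! ### Pointwise linear algebra of almost Hermitian and almost contact metric structures. -/

section Algebra

variable {E₁ : Type*} [NormedAddCommGroup E₁] [NormedSpace ℝ E₁]
  {E₂ : Type*} [NormedAddCommGroup E₂] [NormedSpace ℝ E₂]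

/-- Since `φ²ξ = 0`, the formula for `φ²` at `φξ` gives `φξ = η(φξ)ξ`; applying `φ` and then `η`
gives `η(φξ)² = 0`. -/
theorem almostContact_phi_xi {φ : E₂ →L[ℝ] E₂} {ξ : E₂} {η : E₂ →L[ℝ] ℝ}
    (hφ : ∀ u, φ (φ u) = -u + η u • ξ) (hηξ : η ξ = 1) : φ ξ = 0 := by
  have h1 : φ (φ ξ) = 0 := by rw [hφ, hηξ]; simp
  have h2 : φ ξ = η (φ ξ) • ξ := by
    have := hφ (φ ξ)
    rw [h1, map_zero] at this
    exact (neg_add_eq_zero.1 this.symm)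
  have h3 : η (φ ξ) * η (φ ξ) = 0 := by
    have h4 : η (φ (φ ξ)) = η (φ ξ) * η (φ ξ) := by
      conv_lhs => rw [h2, map_smul, map_smul, smul_eq_mul]
    rw [← h4, h1, map_zero]
  rw [h2, mul_self_eq_zero.1 h3, zero_smul]

/-- Comparison of `φ(φ²u)` with `φ²(φu)`. -/
theorem almostContact_eta_phi {φ : E₂ →L[ℝ] E₂} {ξ : E₂} {η : E₂ →L[ℝ] ℝ}
    (hφ : ∀ u, φ (φ u) = -u + η u • ξ) (hηξ : η ξ = 1) (u : E₂) : η (φ u) = 0 := by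
  have h1 := hφ (φ u)
  rw [hφ u, map_add, map_neg, map_smul, almostContact_phi_xi hφ hηξ, smul_zero, add_zero] at h1
  have h2 : η (φ u) • ξ = 0 := by simpa using h1.symm
  simpa [hηξ] using congrArg η h2

/-- Both sides force `a * c = 0`, where `c` stands for `Xω(X)`. Once that is known, skew-symmetry of
`J` and `φ` moves them onto `X` and `V`: the `w₁` part is minus the pairing of (i) with `w₁`, and
the `w₂` part is `F²` times the pairing of (ii) with `w₂`. -/
theorem warped_variational_iff {b₁ : E₁ →L[ℝ] E₁ →L[ℝ] ℝ} {J : E₁ →L[ℝ] E₁} {θ : E₁ →L[ℝ] ℝ}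
    {b₂ : E₂ →L[ℝ] E₂ →L[ℝ] ℝ} {φ : E₂ →L[ℝ] E₂} {ξ : E₂} {η : E₂ →L[ℝ] ℝ}
    (hb₁ : ∀ v, v ≠ 0 → 0 < b₁ v v) (hb₂ : ∀ v, v ≠ 0 → 0 < b₂ v v)
    (hJ : ∀ u, J (J u) = -u) (hJb : ∀ u v, b₁ (J u) (J v) = b₁ u v)
    (hφ : ∀ u, φ (φ u) = -u + η u • ξ) (hηξ : η ξ = 1)
    (hφb : ∀ u v, b₂ (φ u) (φ v) = b₂ u v - η u * η v)
    {df : E₁ →L[ℝ] ℝ} {grad : E₁} (hgrad : ∀ w, b₁ grad w = df w)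
    {a F c : ℝ} (hF : 0 < F) (X : E₁) (V : E₂) :
    (∀ w₁ w₂, (a * θ X + η V) * (a * (2 * b₁ X (J w₁)) + 2 * b₂ V (φ w₂)) -
      F ^ 2 * η V * (2 * b₂ V (φ w₂)) + 2 * F * df X * (b₂ V w₂ - η V * η w₂) -
      F * df w₁ * (b₂ V V - η V * η V) + a * c * (a * θ w₁ + η w₂) = 0) ↔
    ((2 * a * (a * θ X + η V)) • J X + (F * b₂ (φ V) (φ V)) • grad = 0) ∧
      (-(2 * df X / F) • φ (φ V) + (2 * (-(1 / F ^ 2) * (a * θ X + η V) + η V)) • φ V +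
        (a * (2 * a * (a * θ X + η V) * θ (J X) + c + F * b₂ (φ V) (φ V) * θ grad)) • ξ = 0) := by
  have hηφ := almostContact_eta_phi hφ hηξ
  have hφξ := almostContact_phi_xi hφ hηξ
  have hξ (v : E₂) : b₂ ξ v = η v := by
    have := hφb ξ v
    rw [hφξ, hηξ] at this
    simp at this
    linarith
  have hJs (u w : E₁) : b₁ u (J w) = -b₁ (J u) w := by
    rw [← hJb u (J w), hJ w, map_neg]
  have hφs (u w : E₂) : b₂ u (φ w) = -b₂ (φ u) w := by
    have h1 := hφb u (φ w)
    rw [hφ w, hηφ w] at h1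
    have h2 := hφb (φ u) ξ
    simp only [map_add, map_neg, map_smul, smul_eq_mul] at h1
    rw [hφξ, hηφ, map_zero] at h2
    have h3 : b₂ (φ u) ξ = 0 := by linarith
    rw [h3] at h1
    linarith
  have hφφ (u w : E₂) : b₂ (φ (φ u)) w = -b₂ u w + η u * η w := by
    rw [hφ, map_add, map_neg, map_smul]
    simp [hξ]
  have nd₁ (v : E₁) : v = 0 ↔ ∀ w, b₁ v w = 0 := by
    refine ⟨fun h w => by simp [h], fun h => ?_⟩
    by_contra hv
    exact (hb₁ v hv).ne' (h v)
  have nd₂ (v : E₂) : v = 0 ↔ ∀ w, b₂ v w = 0 := by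
    refine ⟨fun h w => by simp [h], fun h => ?_⟩
    by_contra hv
    exact (hb₂ v hv).ne' (h v)
  have hF0 : F ≠ 0 := hF.ne'
  set K : ℝ := a * θ X + η V with hK
  set Q : ℝ := b₂ (φ V) (φ V) with hQ
  have hQ' : b₂ V V - η V * η V = Q := (hφb V V).symm
  constructor
  · intro h
    have hA (w : E₂) : K * (2 * b₂ V (φ w)) - F ^ 2 * η V * (2 * b₂ V (φ w)) +
        2 * F * df X * (b₂ V w - η V * η w) + a * c * η w = 0 := by
      have := h 0 w
      simp only [map_zero] at this
      linarith
    -- Testing on `ξ`: `φξ = 0` kills the `φ` terms, and `b₂ V ξ - η V * η ξ = b₂ (φ V) (φ ξ) = 0`.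
    have hac : a * c = 0 := by
      have h1 := hA ξ
      have h2 := hφb V ξ
      rw [hφξ, map_zero] at h2
      rw [hφξ, map_zero, hηξ, ← hηξ, ← h2] at h1
      simpa [hηξ] using h1
    have hi : (2 * a * K) • J X + (F * Q) • grad = 0 := by
      rw [nd₁]
      intro w
      have h1 := h w 0
      simp only [map_zero] at h1
      simp only [map_add, map_smul, add_apply, smul_apply,
        smul_eq_mul, hgrad]
      rw [hQ', hac, hJs] at h1
      linarith
    refine ⟨hi, ?_⟩
    have hθ := congrArg θ hi
    simp only [map_add, map_smul, smul_eq_mul, map_zero] at hθ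
    have h0 : a * (2 * a * K * θ (J X) + c + F * Q * θ grad) = 0 := by
      linear_combination a * hθ + hac
    rw [h0, zero_smul, add_zero, nd₂]
    intro w
    have h1 := hA w
    rw [hac, hφs] at h1
    simp only [map_add, map_smul, add_apply, smul_apply,
      smul_eq_mul, hφφ]
    field_simp
    linear_combination h1
  · rintro ⟨hi, hii⟩ w₁ w₂
    have hθ := congrArg θ hi
    simp only [map_add, map_smul, smul_eq_mul, map_zero] at hθ
    -- `η` annihilates the image of `φ`, so (ii) leaves its `ξ`-coefficient; `a` times `θ` of (i)
    -- removes all of it but `a * c`.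
    have hac : a * c = 0 := by
      have h1 := congrArg η hii
      simp only [map_add, map_smul, smul_eq_mul, map_zero, hηφ, hηξ] at h1
      linear_combination h1 - a * hθ
    have h0 : a * (2 * a * K * θ (J X) + c + F * Q * θ grad) = 0 := by
      linear_combination a * hθ + hac
    rw [h0, zero_smul, add_zero, nd₂] at hii
    have h1 := hii w₂
    have h2 := (nd₁ _).1 hi w₁
    simp only [map_add, map_smul, add_apply, smul_apply,
      smul_eq_mul, hφφ] at h1
    simp only [map_add, map_smul, add_apply, smul_apply,
      smul_eq_mul, hgrad] at h2
    rw [hQ', hac, hJs, hφs]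
    field_simp at h1
    linear_combination h1 - h2

end Algebra

/-! ### Velocities and tensors read in a chart. -/

section CurvesInCharts

open Filter Topology

variable {E : Type*} [NormedAddCommGroup E] [NormedSpace ℝ E]
  {M : Type*} [TopologicalSpace M] [ChartedSpace E M]

theorem mfderiv_eq_fderiv_comp_extChartAt_symm {f : M → ℝ} {p : M}
    (hf : ContMDiffAt 𝓘(ℝ, E) 𝓘(ℝ, ℝ) ∞ f p) (v : E) :
    (mfderiv 𝓘(ℝ, E) 𝓘(ℝ, ℝ) f p v : ℝ) =
      fderiv ℝ (fun y => f ((extChartAt 𝓘(ℝ, E) p).symm y)) (extChartAt 𝓘(ℝ, E) p p) v := by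
  rw [(hf.mdifferentiableAt (by simp)).mfderiv, modelWithCornersSelf_coe, range_id,
    fderivWithin_univ]
  rfl

theorem ContDiffAt.differentiableAt_deriv {F : Type*} [NormedAddCommGroup F] [NormedSpace ℝ F]
    {c : ℝ → F} {t : ℝ} (hc : ContDiffAt ℝ 2 c t) : DifferentiableAt ℝ (deriv c) t :=
  ((hc.fderiv_right (m := 1) (by norm_num)).differentiableAt (by simp)).clm_apply
    (differentiableAt_const 1)

theorem contDiffAt_extChartAt_comp {γ : ℝ → M} {t : ℝ}
    (hγ : ContMDiffAt 𝓘(ℝ, ℝ) 𝓘(ℝ, E) ∞ γ t) :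
    ContDiffAt ℝ ∞ (fun τ => extChartAt 𝓘(ℝ, E) (γ t) (γ τ)) t :=
  contMDiffAt_iff_contDiffAt.1
    ((contMDiffAt_extChartAt (n := ∞) (I := 𝓘(ℝ, E)) (x := γ t)).comp t hγ)

variable [IsManifold 𝓘(ℝ, E) ∞ M]

theorem coordFrameModel_mfderiv_extChartAt {p x : M} (hx : x ∈ (extChartAt 𝓘(ℝ, E) p).source)
    (v : E) : coordFrameModel 𝓘(ℝ, E) p (extChartAt 𝓘(ℝ, E) p x)
      (mfderiv 𝓘(ℝ, E) 𝓘(ℝ, E) (extChartAt 𝓘(ℝ, E) p) x v) = v := by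
  obtain ⟨y, hy, rfl⟩ : ∃ y ∈ (extChartAt 𝓘(ℝ, E) p).target, (extChartAt 𝓘(ℝ, E) p).symm y = x :=
    ⟨_, (extChartAt 𝓘(ℝ, E) p).map_source hx, (extChartAt 𝓘(ℝ, E) p).left_inv hx⟩
  rw [(extChartAt 𝓘(ℝ, E) p).right_inv hy]
  exact coordFrame_comp_mfderiv_extChartAt hy v

theorem mfderiv_extChartAt_center (p : M) (v : E) :
    mfderiv 𝓘(ℝ, E) 𝓘(ℝ, E) (extChartAt 𝓘(ℝ, E) p) p v = v := by
  have h := coordFrameModel_mfderiv_extChartAt (mem_extChartAt_source (I := 𝓘(ℝ, E)) p) v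
  exact (coordFrame_center p _).symm.trans h

theorem chartForm_mfderiv_extChartAt (ω₁ : ∀ x : M, TangentSpace 𝓘(ℝ, E) x →L[ℝ] ℝ) {p x : M}
    (hx : x ∈ (extChartAt 𝓘(ℝ, E) p).source) (v : TangentSpace 𝓘(ℝ, E) x) :
    chartForm 𝓘(ℝ, E) ω₁ p (extChartAt 𝓘(ℝ, E) p x)
      (mfderiv 𝓘(ℝ, E) 𝓘(ℝ, E) (extChartAt 𝓘(ℝ, E) p) x v) = ω₁ x v := by
  obtain ⟨y, hy, rfl⟩ : ∃ y ∈ (extChartAt 𝓘(ℝ, E) p).target, (extChartAt 𝓘(ℝ, E) p).symm y = x :=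
    ⟨_, (extChartAt 𝓘(ℝ, E) p).map_source hx, (extChartAt 𝓘(ℝ, E) p).left_inv hx⟩
  rw [(extChartAt 𝓘(ℝ, E) p).right_inv hy]
  exact congrArg (ω₁ _) (coordFrame_comp_mfderiv_extChartAt hy v)

theorem chartForm_center (ω₁ : ∀ x : M, TangentSpace 𝓘(ℝ, E) x →L[ℝ] ℝ) (p : M) (v : E) :
    chartForm 𝓘(ℝ, E) ω₁ p (extChartAt 𝓘(ℝ, E) p p) v = ω₁ p v := by
  have h := chartForm_mfderiv_extChartAt ω₁ (mem_extChartAt_source (I := 𝓘(ℝ, E)) p) v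
  rwa [mfderiv_extChartAt_center] at h

theorem chartMetric_center
    (g : ∀ x : M, TangentSpace 𝓘(ℝ, E) x →L[ℝ] TangentSpace 𝓘(ℝ, E) x →L[ℝ] ℝ) (p : M) (u v : E) :
    chartMetric 𝓘(ℝ, E) g p (extChartAt 𝓘(ℝ, E) p p) u v = g p u v := by
  -- The base point `(extChartAt p).symm (extChartAt p p)` equals `p` only propositionally; all
  -- tangent spaces being `E`, the equality is transported for fixed model vectors.
  have h (x : M) (hx : x = p) (u v : E) : g x u v = g p u v := by subst hx; rfl
  refine Eq.trans ?_ (h _ (extChartAt_to_inv (I := 𝓘(ℝ, E)) p) u v)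
  have e (w : E) : coordFrame 𝓘(ℝ, E) p (extChartAt 𝓘(ℝ, E) p p) w = w := coordFrame_center p w
  change g _ (coordFrame 𝓘(ℝ, E) p (extChartAt 𝓘(ℝ, E) p p) u)
    (coordFrame 𝓘(ℝ, E) p (extChartAt 𝓘(ℝ, E) p p) v) = _
  rw [e u, e v]

theorem chartForm_eq_chartMetric_chartField
    {g : ∀ x : M, TangentSpace 𝓘(ℝ, E) x →L[ℝ] TangentSpace 𝓘(ℝ, E) x →L[ℝ] ℝ}
    {ξ : ∀ x : M, TangentSpace 𝓘(ℝ, E) x} {η : ∀ x : M, TangentSpace 𝓘(ℝ, E) x →L[ℝ] ℝ}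
    (h : ∀ x v, η x v = g x (ξ x) v) {p : M} {y : E} (hy : y ∈ (extChartAt 𝓘(ℝ, E) p).target) :
    chartForm 𝓘(ℝ, E) η p y = chartMetric 𝓘(ℝ, E) g p y (chartField 𝓘(ℝ, E) ξ p y) := by
  ext v
  have e := coordFrame_comp_mfderiv_extChartAt hy (ξ ((extChartAt 𝓘(ℝ, E) p).symm y))
  change η _ (coordFrame 𝓘(ℝ, E) p y v) = g _ (coordFrame 𝓘(ℝ, E) p y _) _
  rw [h]
  exact congrArg (fun w => g _ w (coordFrame 𝓘(ℝ, E) p y v)) e.symm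

variable {γ : ℝ → M} {t : ℝ}

theorem deriv_extChartAt_comp {p : M} (hγ : ContMDiffAt 𝓘(ℝ, ℝ) 𝓘(ℝ, E) ∞ γ t)
    (hp : γ t ∈ (extChartAt 𝓘(ℝ, E) p).source) :
    deriv (fun τ => extChartAt 𝓘(ℝ, E) p (γ τ)) t =
      mfderiv 𝓘(ℝ, E) 𝓘(ℝ, E) (extChartAt 𝓘(ℝ, E) p) (γ t) (velocity 𝓘(ℝ, E) γ t) := by
  have h1 : MDifferentiableAt 𝓘(ℝ, E) 𝓘(ℝ, E) (extChartAt 𝓘(ℝ, E) p) (γ t) :=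
    (contMDiffAt_extChartAt' (n := ∞) (by simpa using hp)).mdifferentiableAt (by simp)
  have h2 := mfderiv_comp t h1 (hγ.mdifferentiableAt (by simp))
  rw [mfderiv_eq_fderiv] at h2
  rw [← fderiv_apply_one_eq_deriv]
  exact DFunLike.congr_fun h2 (1 : ℝ)

theorem velocity_eq_deriv_extChartAt_comp (hγ : ContMDiffAt 𝓘(ℝ, ℝ) 𝓘(ℝ, E) ∞ γ t) :
    velocity 𝓘(ℝ, E) γ t = deriv (fun τ => extChartAt 𝓘(ℝ, E) (γ t) (γ τ)) t :=
  ((deriv_extChartAt_comp hγ (mem_extChartAt_source _)).trans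
    (mfderiv_extChartAt_center (γ t) _)).symm

/-- Product rule for `Ω(c)(c')`, with the chart frozen at `γ t`. Reading the velocity at nearby
times in this one chart is why smoothness is needed around `t`. -/
theorem deriv_form_velocity {ω₁ : ∀ x : M, TangentSpace 𝓘(ℝ, E) x →L[ℝ] ℝ}
    (hω : SmoothOneForm 𝓘(ℝ, E) ω₁) (hγ : ∀ᶠ τ in 𝓝 t, ContMDiffAt 𝓘(ℝ, ℝ) 𝓘(ℝ, E) ∞ γ τ) :
    deriv (fun τ => ω₁ (γ τ) (velocity 𝓘(ℝ, E) γ τ)) t =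
      fderiv ℝ (chartForm 𝓘(ℝ, E) ω₁ (γ t)) (extChartAt 𝓘(ℝ, E) (γ t) (γ t))
        (velocity 𝓘(ℝ, E) γ t) (velocity 𝓘(ℝ, E) γ t) +
      ω₁ (γ t) (deriv (deriv (fun τ => extChartAt 𝓘(ℝ, E) (γ t) (γ τ))) t) := by
  have hγt := hγ.self_of_nhds
  have hcd := contDiffAt_extChartAt_comp hγt
  rw [velocity_eq_deriv_extChartAt_comp hγt]
  have h1 : (fun τ => ω₁ (γ τ) (velocity 𝓘(ℝ, E) γ τ)) =ᶠ[𝓝 t]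
      fun τ => chartForm 𝓘(ℝ, E) ω₁ (γ t) (extChartAt 𝓘(ℝ, E) (γ t) (γ τ))
        (deriv (fun τ => extChartAt 𝓘(ℝ, E) (γ t) (γ τ)) τ) := by
    filter_upwards [hγ, hγt.continuousAt.preimage_mem_nhds
      (extChartAt_source_mem_nhds (I := 𝓘(ℝ, E)) (γ t))] with τ hτ hs
    rw [deriv_extChartAt_comp hτ hs]
    exact (chartForm_mfderiv_extChartAt ω₁ hs _).symm
  rw [h1.deriv_eq]
  refine Eq.trans ?_ (congrArg _ (chartForm_center ω₁ (γ t) _))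
  have hΩ := differentiableAt_chartForm hω (γ t)
  generalize chartForm 𝓘(ℝ, E) ω₁ (γ t) = Ω at hΩ ⊢
  generalize hc : (fun τ => extChartAt 𝓘(ℝ, E) (γ t) (γ τ)) = c at hcd ⊢
  have hct (τ : ℝ) : extChartAt 𝓘(ℝ, E) (γ t) (γ τ) = c τ := by rw [← hc]
  simp only [hct] at hΩ ⊢
  exact (hΩ.hasFDerivAt.comp_hasDerivAt t
    (hcd.differentiableAt (by simp)).hasDerivAt).clm_apply
      (hcd.of_le ENat.LEInfty.out).differentiableAt_deriv.hasDerivAt |>.deriv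

end CurvesInCharts

/-! ### The warped metric in product charts, and the theorem. -/

section WarpedProduct

open Filter Topology

variable {E₁ : Type*} [NormedAddCommGroup E₁] [NormedSpace ℝ E₁]
  {M₁ : Type*} [TopologicalSpace M₁] [ChartedSpace E₁ M₁] [IsManifold 𝓘(ℝ, E₁) ∞ M₁]
  {E₂ : Type*} [NormedAddCommGroup E₂] [NormedSpace ℝ E₂]
  {M₂ : Type*} [TopologicalSpace M₂] [ChartedSpace E₂ M₂] [IsManifold 𝓘(ℝ, E₂) ∞ M₂]

/-- The transition map between product charts is a product map, and derivatives are unique. -/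
theorem coordFrameModel_prod {p : M₁ × M₂} {y : E₁ × E₂}
    (hy₁ : y.1 ∈ (extChartAt 𝓘(ℝ, E₁) p.1).target) (hy₂ : y.2 ∈ (extChartAt 𝓘(ℝ, E₂) p.2).target) :
    coordFrameModel (𝓘(ℝ, E₁).prod 𝓘(ℝ, E₂)) p y =
      (coordFrameModel 𝓘(ℝ, E₁) p.1 y.1).prodMap (coordFrameModel 𝓘(ℝ, E₂) p.2 y.2) := by
  have hy : y ∈ (extChartAt (𝓘(ℝ, E₁).prod 𝓘(ℝ, E₂)) p).target := by
    rw [extChartAt_prod]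
    exact ⟨hy₁, hy₂⟩
  have h := hasFDerivAt_transition hy
  simp only [extChartAt_prod] at h
  exact h.unique ((hasFDerivAt_transition hy₁).prodMap y (hasFDerivAt_transition hy₂))

/-- The warped product metric in the product of two charts. -/
theorem chartMetric_warpedMetric (a : ℝ) (f : M₁ → ℝ)
    (g₁ : ∀ x : M₁, TangentSpace 𝓘(ℝ, E₁) x →L[ℝ] TangentSpace 𝓘(ℝ, E₁) x →L[ℝ] ℝ)
    (ω₁ : ∀ x : M₁, TangentSpace 𝓘(ℝ, E₁) x →L[ℝ] ℝ)
    (g₂ : ∀ x : M₂, TangentSpace 𝓘(ℝ, E₂) x →L[ℝ] TangentSpace 𝓘(ℝ, E₂) x →L[ℝ] ℝ)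
    (η : ∀ x : M₂, TangentSpace 𝓘(ℝ, E₂) x →L[ℝ] ℝ) {p : M₁ × M₂} {y : E₁ × E₂}
    (hy₁ : y.1 ∈ (extChartAt 𝓘(ℝ, E₁) p.1).target) (hy₂ : y.2 ∈ (extChartAt 𝓘(ℝ, E₂) p.2).target)
    (u v : E₁ × E₂) :
    chartMetric (𝓘(ℝ, E₁).prod 𝓘(ℝ, E₂))
      (warpedMetric 𝓘(ℝ, E₁) 𝓘(ℝ, E₂) a f g₁ ω₁ g₂ η) p y u v =
    warpedForm a (fun z => f ((extChartAt 𝓘(ℝ, E₁) p.1).symm z)) (chartMetric 𝓘(ℝ, E₁) g₁ p.1)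
      (chartForm 𝓘(ℝ, E₁) ω₁ p.1) (chartMetric 𝓘(ℝ, E₂) g₂ p.2) (chartForm 𝓘(ℝ, E₂) η p.2)
      u v y := by
  have e (w : E₁ × E₂) : coordFrame (𝓘(ℝ, E₁).prod 𝓘(ℝ, E₂)) p y w =
      (coordFrame 𝓘(ℝ, E₁) p.1 y.1 w.1, coordFrame 𝓘(ℝ, E₂) p.2 y.2 w.2) :=
    DFunLike.congr_fun (coordFrameModel_prod hy₁ hy₂) w
  change warpedMetric 𝓘(ℝ, E₁) 𝓘(ℝ, E₂) a f g₁ ω₁ g₂ η _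
    (coordFrame (𝓘(ℝ, E₁).prod 𝓘(ℝ, E₂)) p y u) (coordFrame (𝓘(ℝ, E₁).prod 𝓘(ℝ, E₂)) p y v) = _
  rw [e u, e v]
  rfl

/-- `G₂ - Θ ⊗ Θ` is the pull-back of `G₂` by `φ`, so all three terms are nonnegative. If `v₁ = 0`
and `φ v₂ = 0`, then `v₂ = Θ(v₂)ξ`, and the square of `η̄` is positive. -/
theorem warpedForm_self_pos {a : ℝ} {F : E₁ → ℝ} {G₁ : E₁ → E₁ →L[ℝ] E₁ →L[ℝ] ℝ}
    {Ω : E₁ → E₁ →L[ℝ] ℝ} {G₂ : E₂ → E₂ →L[ℝ] E₂ →L[ℝ] ℝ} {Θ : E₂ → E₂ →L[ℝ] ℝ} {y : E₁ × E₂}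
    {φ : E₂ →L[ℝ] E₂} {ξ : E₂} (hF : 0 < F y.1) (hG₁ : ∀ v, v ≠ 0 → 0 < G₁ y.1 v v)
    (hG₂ : ∀ v, v ≠ 0 → 0 < G₂ y.2 v v) (hφ : ∀ u, φ (φ u) = -u + Θ y.2 u • ξ)
    (hφG : ∀ u v, G₂ y.2 (φ u) (φ v) = G₂ y.2 u v - Θ y.2 u * Θ y.2 v)
    {v : E₁ × E₂} (hv : v ≠ 0) : 0 < warpedForm a F G₁ Ω G₂ Θ v v y := by
  rw [warpedForm, ← hφG]
  have h0 : 0 ≤ F y.1 ^ 2 * G₂ y.2 (φ v.2) (φ v.2) := by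
    by_cases h : φ v.2 = 0
    · simp [h]
    · have := hG₂ _ h
      positivity
  have h3 := mul_self_nonneg (a * Ω y.1 v.1 + Θ y.2 v.2)
  by_cases h1 : v.1 = 0
  · have hv2 : v.2 ≠ 0 := fun h => hv (Prod.ext h1 h)
    simp only [h1, map_zero, mul_zero, zero_add] at h3 ⊢
    by_cases h : φ v.2 = 0
    · have h4 : Θ y.2 v.2 ≠ 0 := by
        intro h5
        have := hφ v.2
        rw [h, map_zero, h5, zero_smul, add_zero] at this
        exact hv2 (neg_eq_zero.1 this.symm)
      simp only [h, map_zero, mul_zero, zero_add]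
      exact mul_self_pos.2 h4
    · have := mul_pos (pow_pos hF 2) (hG₂ _ h)
      linarith
  · linarith [hG₁ _ h1]

theorem deriv_prodMk_pair {c₁ : ℝ → E₁} {c₂ : ℝ → E₂} {t : ℝ} (h₁ : DifferentiableAt ℝ c₁ t)
    (h₂ : DifferentiableAt ℝ c₂ t) : deriv (fun τ => (c₁ τ, c₂ τ)) t = (deriv c₁ t, deriv c₂ t) :=
  (h₁.hasDerivAt.prodMk h₂.hasDerivAt).deriv

theorem deriv_deriv_prodMk_pair {c₁ : ℝ → E₁} {c₂ : ℝ → E₂} {t : ℝ} (h₁ : ContDiffAt ℝ 2 c₁ t)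
    (h₂ : ContDiffAt ℝ 2 c₂ t) : deriv (deriv fun τ => (c₁ τ, c₂ τ)) t =
      (deriv (deriv c₁) t, deriv (deriv c₂) t) := by
  have h : (deriv fun τ => (c₁ τ, c₂ τ)) =ᶠ[𝓝 t] fun τ => (deriv c₁ τ, deriv c₂ τ) := by
    filter_upwards [h₁.eventually (by simp), h₂.eventually (by simp)] with τ k₁ k₂
    exact deriv_prodMk_pair (k₁.differentiableAt (by simp)) (k₂.differentiableAt (by simp))
  rw [h.deriv_eq]
  exact deriv_prodMk_pair h₁.differentiableAt_deriv h₂.differentiableAt_deriv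

/-- The covariant acceleration, in terms of the velocity. -/
theorem covAccel_eq {g : ∀ x : M₁, TangentSpace 𝓘(ℝ, E₁) x →L[ℝ] TangentSpace 𝓘(ℝ, E₁) x →L[ℝ] ℝ}
    {γ : ℝ → M₁} {t : ℝ} (hγ : ContMDiffAt 𝓘(ℝ, ℝ) 𝓘(ℝ, E₁) ∞ γ t) :
    covAccel 𝓘(ℝ, E₁) g γ t = (deriv (deriv fun τ => extChartAt 𝓘(ℝ, E₁) (γ t) (γ τ)) t +
      christoffel (chartMetric 𝓘(ℝ, E₁) g (γ t)) (extChartAt 𝓘(ℝ, E₁) (γ t) (γ t))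
        (velocity 𝓘(ℝ, E₁) γ t) (velocity 𝓘(ℝ, E₁) γ t) : E₁) := by
  rw [velocity_eq_deriv_extChartAt_comp hγ]
  rfl

theorem covAccel_prodMk {γ : ℝ → M₁} {β : ℝ → M₂} {t : ℝ}
    (hγ : ContMDiffAt 𝓘(ℝ, ℝ) 𝓘(ℝ, E₁) ∞ γ t) (hβ : ContMDiffAt 𝓘(ℝ, ℝ) 𝓘(ℝ, E₂) ∞ β t)
    (g : ∀ x : M₁ × M₂, TangentSpace (𝓘(ℝ, E₁).prod 𝓘(ℝ, E₂)) x →L[ℝ]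
      TangentSpace (𝓘(ℝ, E₁).prod 𝓘(ℝ, E₂)) x →L[ℝ] ℝ) :
    covAccel (𝓘(ℝ, E₁).prod 𝓘(ℝ, E₂)) g (fun t => (γ t, β t)) t =
      (((deriv (deriv fun τ => extChartAt 𝓘(ℝ, E₁) (γ t) (γ τ)) t,
        deriv (deriv fun τ => extChartAt 𝓘(ℝ, E₂) (β t) (β τ)) t) : E₁ × E₂) +
      christoffel (chartMetric (𝓘(ℝ, E₁).prod 𝓘(ℝ, E₂)) g (γ t, β t))
        (extChartAt 𝓘(ℝ, E₁) (γ t) (γ t), extChartAt 𝓘(ℝ, E₂) (β t) (β t))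
        (velocity 𝓘(ℝ, E₁) γ t, velocity 𝓘(ℝ, E₂) β t)
        (velocity 𝓘(ℝ, E₁) γ t, velocity 𝓘(ℝ, E₂) β t) : E₁ × E₂) := by
  have h₁ := contDiffAt_extChartAt_comp hγ
  have h₂ := contDiffAt_extChartAt_comp hβ
  rw [velocity_eq_deriv_extChartAt_comp hγ, velocity_eq_deriv_extChartAt_comp hβ,
    ← deriv_deriv_prodMk_pair (h₁.of_le ENat.LEInfty.out) (h₂.of_le ENat.LEInfty.out),
    ← deriv_prodMk_pair (h₁.differentiableAt (by simp)) (h₂.differentiableAt (by simp))]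
  have hc : (fun τ => extChartAt (𝓘(ℝ, E₁).prod 𝓘(ℝ, E₂)) (γ t, β t) (γ τ, β τ)) =
      fun τ => (extChartAt 𝓘(ℝ, E₁) (γ t) (γ τ), extChartAt 𝓘(ℝ, E₂) (β t) (β τ)) := by
    funext τ
    rw [extChartAt_prod]
    rfl
  rw [← hc]
  simp only [covAccel]
  rw [extChartAt_prod]
  rfl

/-- On an almost contact metric manifold, `η` is the metric dual of `ξ`. -/
theorem IsAlmostContactMetric.inner_xi
    {φ : ∀ x : M₂, TangentSpace 𝓘(ℝ, E₂) x →L[ℝ] TangentSpace 𝓘(ℝ, E₂) x}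
    {ξ : ∀ x : M₂, TangentSpace 𝓘(ℝ, E₂) x} {η : ∀ x : M₂, TangentSpace 𝓘(ℝ, E₂) x →L[ℝ] ℝ}
    {g : ContMDiffRiemannianMetric 𝓘(ℝ, E₂) ∞ E₂ (fun x : M₂ => TangentSpace 𝓘(ℝ, E₂) x)}
    (h : IsAlmostContactMetric 𝓘(ℝ, E₂) φ ξ η g) (x : M₂) (v : TangentSpace 𝓘(ℝ, E₂) x) :
    η x v = g.inner x (ξ x) v := by
  have h1 : φ x (ξ x) = 0 :=
    almostContact_phi_xi (E₂ := E₂) (φ := φ x) (ξ := ξ x) (η := η x) (h.φ_sq x) (h.η_ξ x)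
  have h2 := h.compat x (ξ x) v
  rw [h1, h.η_ξ] at h2
  simp at h2
  linarith

/-- Along a geodesic of a K-contact manifold, `η(V)` is constant. -/
theorem IsKContact.fderiv_chartForm_add_eq_zero [FiniteDimensional ℝ E₂]
    {φ : ∀ x : M₂, TangentSpace 𝓘(ℝ, E₂) x →L[ℝ] TangentSpace 𝓘(ℝ, E₂) x}
    {ξ : ∀ x : M₂, TangentSpace 𝓘(ℝ, E₂) x} {η : ∀ x : M₂, TangentSpace 𝓘(ℝ, E₂) x →L[ℝ] ℝ}
    {g : ContMDiffRiemannianMetric 𝓘(ℝ, E₂) ∞ E₂ (fun x : M₂ => TangentSpace 𝓘(ℝ, E₂) x)}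
    (h : IsKContact 𝓘(ℝ, E₂) φ ξ η g) {x : M₂} {A u : E₂}
    (hA : A + christoffel (chartMetric 𝓘(ℝ, E₂) g.inner x) (extChartAt 𝓘(ℝ, E₂) x x) u u = 0) :
    fderiv ℝ (chartForm 𝓘(ℝ, E₂) η x) (extChartAt 𝓘(ℝ, E₂) x x) u u +
      chartForm 𝓘(ℝ, E₂) η x (extChartAt 𝓘(ℝ, E₂) x x) A = 0 := by
  refine fderiv_add_eq_zero_of_killing (G := chartMetric 𝓘(ℝ, E₂) g.inner x)
    (Ξ := chartField 𝓘(ℝ, E₂) ξ x) ?_ (differentiableAt_chartMetric g x)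
    (differentiableAt_chartField h.smooth_ξ x) ?_ ?_ (h.killing x u u) hA
  · refine ContinuousLinearMap.isInvertible_of_posDef fun v hv => ?_
    rw [chartMetric_center]
    exact g.pos x v hv
  · exact Eventually.of_forall fun z v w => g.symm _ _ _
  · filter_upwards [extChartAt_target_mem_nhds (I := 𝓘(ℝ, E₂)) x] with z hz
    exact chartForm_eq_chartMetric_chartField h.inner_xi hz

theorem inner_metricGradient [FiniteDimensional ℝ E₁]
    (g : ContMDiffRiemannianMetric 𝓘(ℝ, E₁) ∞ E₁ (fun x : M₁ => TangentSpace 𝓘(ℝ, E₁) x))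
    (f : M₁ → ℝ) (x : M₁) (w : TangentSpace 𝓘(ℝ, E₁) x) :
    g.inner x (metricGradient 𝓘(ℝ, E₁) g.inner f x) w = mfderiv 𝓘(ℝ, E₁) 𝓘(ℝ, ℝ) f x w := by
  obtain ⟨e, he⟩ : (g.inner x).IsInvertible :=
    ContinuousLinearMap.isInvertible_of_posDef (E := E₁) (g.pos x)
  rw [metricGradient, ← he, ContinuousLinearMap.inverse_equiv]
  exact DFunLike.congr_fun (e.apply_symm_apply _) w

/-- The geodesic equation of the warped product metric at a point, for velocities `X`, `V` and
second derivatives `A₁`, `A₂` that satisfy the geodesic equations of the factors. -/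
theorem warped_geodesic_equation_iff [FiniteDimensional ℝ E₁] [FiniteDimensional ℝ E₂]
    {g₁ : ContMDiffRiemannianMetric 𝓘(ℝ, E₁) ∞ E₁ (fun x : M₁ => TangentSpace 𝓘(ℝ, E₁) x)}
    {J : ∀ x : M₁, TangentSpace 𝓘(ℝ, E₁) x →L[ℝ] TangentSpace 𝓘(ℝ, E₁) x}
    (hM₁ : IsAlmostHermitian 𝓘(ℝ, E₁) J g₁)
    {ω₁ : ∀ x : M₁, TangentSpace 𝓘(ℝ, E₁) x →L[ℝ] ℝ} (hω : SmoothOneForm 𝓘(ℝ, E₁) ω₁)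
    (hdω : ∀ (x : M₁) (u v : TangentSpace 𝓘(ℝ, E₁) x),
      extDerivOneForm 𝓘(ℝ, E₁) ω₁ x u v = g₁.inner x u (J x v))
    {g₂ : ContMDiffRiemannianMetric 𝓘(ℝ, E₂) ∞ E₂ (fun x : M₂ => TangentSpace 𝓘(ℝ, E₂) x)}
    {φ : ∀ x : M₂, TangentSpace 𝓘(ℝ, E₂) x →L[ℝ] TangentSpace 𝓘(ℝ, E₂) x}
    {ξ : ∀ x : M₂, TangentSpace 𝓘(ℝ, E₂) x} {η : ∀ x : M₂, TangentSpace 𝓘(ℝ, E₂) x →L[ℝ] ℝ}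
    (hM₂ : IsKContact 𝓘(ℝ, E₂) φ ξ η g₂)
    {a : ℝ} {f : M₁ → ℝ} (hf : ContMDiff 𝓘(ℝ, E₁) 𝓘(ℝ, ℝ) ∞ f) (hf_pos : ∀ x, 0 < f x)
    {p : M₁} {q : M₂} {X A₁ : E₁} {V A₂ : E₂} {c d : ℝ}
    (h₁ : A₁ + christoffel (chartMetric 𝓘(ℝ, E₁) g₁.inner p) (extChartAt 𝓘(ℝ, E₁) p p) X X = 0)
    (h₂ : A₂ + christoffel (chartMetric 𝓘(ℝ, E₂) g₂.inner q) (extChartAt 𝓘(ℝ, E₂) q q) V V = 0)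
    (hc : c = fderiv ℝ (chartForm 𝓘(ℝ, E₁) ω₁ p) (extChartAt 𝓘(ℝ, E₁) p p) X X + ω₁ p A₁)
    (hd : d = mfderiv 𝓘(ℝ, E₁) 𝓘(ℝ, ℝ) f p X) :
    ((A₁, A₂) + christoffel (chartMetric (𝓘(ℝ, E₁).prod 𝓘(ℝ, E₂))
        (warpedMetric 𝓘(ℝ, E₁) 𝓘(ℝ, E₂) a f g₁.inner ω₁ g₂.inner η) (p, q))
      (extChartAt 𝓘(ℝ, E₁) p p, extChartAt 𝓘(ℝ, E₂) q q) (X, V) (X, V) : E₁ × E₂) = 0 ↔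
    ((2 * a * (a * ω₁ p X + η q V)) • J p X +
        (f p * g₂.inner q (φ q V) (φ q V)) • metricGradient 𝓘(ℝ, E₁) g₁.inner f p = 0) ∧
      (-(2 * d / f p) • φ q (φ q V) +
        (2 * (-(1 / f p ^ 2) * (a * ω₁ p X + η q V) + η q V)) • φ q V +
        (a * (2 * a * (a * ω₁ p X + η q V) * ω₁ p (J p X) + c +
          f p * g₂.inner q (φ q V) (φ q V) * ω₁ p (metricGradient 𝓘(ℝ, E₁) g₁.inner f p))) • ξ q =
        0) := by
  have hG₁ (v : E₁) (hv : v ≠ 0) :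
      0 < chartMetric 𝓘(ℝ, E₁) g₁.inner p (extChartAt 𝓘(ℝ, E₁) p p) v v := by
    rw [chartMetric_center]
    exact g₁.pos _ v hv
  have hG₂ (v : E₂) (hv : v ≠ 0) :
      0 < chartMetric 𝓘(ℝ, E₂) g₂.inner q (extChartAt 𝓘(ℝ, E₂) q q) v v := by
    rw [chartMetric_center]
    exact g₂.pos _ v hv
  have hG : ∀ᶠ z in 𝓝 ((extChartAt 𝓘(ℝ, E₁) p p, extChartAt 𝓘(ℝ, E₂) q q) :
      E₁ × E₂), ∀ u v, chartMetric (𝓘(ℝ, E₁).prod 𝓘(ℝ, E₂))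
        (warpedMetric 𝓘(ℝ, E₁) 𝓘(ℝ, E₂) a f g₁.inner ω₁ g₂.inner η) (p, q) z u v =
      warpedForm a (fun z => f ((extChartAt 𝓘(ℝ, E₁) p).symm z))
        (chartMetric 𝓘(ℝ, E₁) g₁.inner p) (chartForm 𝓘(ℝ, E₁) ω₁ p)
        (chartMetric 𝓘(ℝ, E₂) g₂.inner q) (chartForm 𝓘(ℝ, E₂) η q) u v z := by
    -- The identity is needed on a neighbourhood, since the Christoffel symbols differentiate the
    -- metric.
    filter_upwards [prod_mem_nhds (extChartAt_target_mem_nhds (I := 𝓘(ℝ, E₁)) p)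
      (extChartAt_target_mem_nhds (I := 𝓘(ℝ, E₂)) q)] with z hz u v
    exact chartMetric_warpedMetric a f g₁.inner ω₁ g₂.inner η (p := (p, q)) hz.1 hz.2 u v
  have hpos (v : E₁ × E₂) (hv : v ≠ 0) := warpedForm_self_pos (a := a)
    (Ω := chartForm 𝓘(ℝ, E₁) ω₁ p) (Θ := chartForm 𝓘(ℝ, E₂) η q) (φ := φ q)
    (ξ := ξ q) (F := fun z => f ((extChartAt 𝓘(ℝ, E₁) p).symm z))
    (y := (extChartAt 𝓘(ℝ, E₁) p p, extChartAt 𝓘(ℝ, E₂) q q))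
    (hf_pos _) hG₁ hG₂
    (fun u => by rw [chartForm_center]; exact hM₂.φ_sq q u)
    (fun u v => by
      simp only [chartForm_center, chartMetric_center]
      exact hM₂.compat q u v) hv
  have key := add_christoffel_warped_eq_zero_iff hG
    (ContinuousLinearMap.isInvertible_of_posDef fun v hv => by
      rw [hG.self_of_nhds]
      exact hpos v hv)
    (ContinuousLinearMap.isInvertible_of_posDef hG₁)
    (ContinuousLinearMap.isInvertible_of_posDef hG₂)
    (hf p).differentiableAt_comp_extChartAt_symm (differentiableAt_chartMetric g₁ p)
    (differentiableAt_chartForm hω p) (differentiableAt_chartMetric g₂ q)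
    (differentiableAt_chartForm hM₂.smooth_η q) (A₁, A₂) (X, V) h₁ h₂
    (hM₂.fderiv_chartForm_add_eq_zero h₂)
  refine key.trans ?_
  subst hd
  have alg := warped_variational_iff (E₁ := E₁) (E₂ := E₂) (b₁ := g₁.inner p) (J := J p)
    (θ := ω₁ p) (b₂ := g₂.inner q) (φ := φ q) (ξ := ξ q) (η := η q) (g₁.pos _) (g₂.pos _)
    (hM₁.J_sq _) (hM₁.compat _) (hM₂.φ_sq _) (hM₂.η_ξ _) (hM₂.compat _)
    (inner_metricGradient g₁ f p) (a := a) (c := c) (hf_pos p) X V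
  refine Iff.trans (forall₂_congr fun w₁ w₂ => ?_) alg
  -- The factor `2` undoes the normalisation `1/2` in `extDerivOneForm`; likewise for `η` below.
  have hdω' : fderiv ℝ (chartForm 𝓘(ℝ, E₁) ω₁ p) (extChartAt 𝓘(ℝ, E₁) p p) X w₁ -
      fderiv ℝ (chartForm 𝓘(ℝ, E₁) ω₁ p) (extChartAt 𝓘(ℝ, E₁) p p) w₁ X =
      2 * g₁.inner p X (J p w₁) := by
    have h := hdω p X w₁
    rw [extDerivOneForm] at h
    linarith
  have hdη : fderiv ℝ (chartForm 𝓘(ℝ, E₂) η q) (extChartAt 𝓘(ℝ, E₂) q q) V w₂ -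
      fderiv ℝ (chartForm 𝓘(ℝ, E₂) η q) (extChartAt 𝓘(ℝ, E₂) q q) w₂ V =
      2 * g₂.inner q V (φ q w₂) := by
    have h := hM₂.d_η q V w₂
    rw [extDerivOneForm] at h
    linarith
  simp only [chartForm_center, chartMetric_center, extChartAt_to_inv, hdω', hdη, ← hc,
    ← mfderiv_eq_fderiv_comp_extChartAt_symm (hf p)]
  rfl

end WarpedProduct

theorem theorem4p5
    {E₁ : Type*} [NormedAddCommGroup E₁] [NormedSpace ℝ E₁] [FiniteDimensional ℝ E₁]
    {M₁ : Type*} [TopologicalSpace M₁] [ChartedSpace E₁ M₁] [IsManifold 𝓘(ℝ, E₁) ∞ M₁]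
    {E₂ : Type*} [NormedAddCommGroup E₂] [NormedSpace ℝ E₂] [FiniteDimensional ℝ E₂]
    {M₂ : Type*} [TopologicalSpace M₂] [ChartedSpace E₂ M₂] [IsManifold 𝓘(ℝ, E₂) ∞ M₂]
    -- the almost Hermitian manifold `M₁`, with a 1-form `ω₁` such that `dω₁ = Φ₁`
    (g₁ : ContMDiffRiemannianMetric 𝓘(ℝ, E₁) ∞ E₁ (fun x : M₁ => TangentSpace 𝓘(ℝ, E₁) x))
    (J : ∀ x : M₁, TangentSpace 𝓘(ℝ, E₁) x →L[ℝ] TangentSpace 𝓘(ℝ, E₁) x)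
    (hM₁ : IsAlmostHermitian 𝓘(ℝ, E₁) J g₁)
    (ω₁ : ∀ x : M₁, TangentSpace 𝓘(ℝ, E₁) x →L[ℝ] ℝ)
    (hω : SmoothOneForm 𝓘(ℝ, E₁) ω₁)
    (hdω : ∀ (x : M₁) (u v : TangentSpace 𝓘(ℝ, E₁) x),
      extDerivOneForm 𝓘(ℝ, E₁) ω₁ x u v = g₁.inner x u (J x v))
    -- the K-contact manifold `M₂`
    (g₂ : ContMDiffRiemannianMetric 𝓘(ℝ, E₂) ∞ E₂ (fun x : M₂ => TangentSpace 𝓘(ℝ, E₂) x))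
    (φ : ∀ x : M₂, TangentSpace 𝓘(ℝ, E₂) x →L[ℝ] TangentSpace 𝓘(ℝ, E₂) x)
    (ξ : ∀ x : M₂, TangentSpace 𝓘(ℝ, E₂) x)
    (η : ∀ x : M₂, TangentSpace 𝓘(ℝ, E₂) x →L[ℝ] ℝ)
    (hM₂ : IsKContact 𝓘(ℝ, E₂) φ ξ η g₂)
    -- the constant and the warping function
    (a : ℝ) (f : M₁ → ℝ) (hf : ContMDiff 𝓘(ℝ, E₁) 𝓘(ℝ, ℝ) ∞ f) (hf_pos : ∀ x, 0 < f x)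
    -- the geodesics, defined on an open interval `s`
    (s : Set ℝ) (hs : IsOpen s) (hs' : s.OrdConnected)
    (γ : ℝ → M₁) (hγ : IsGeodesicOn 𝓘(ℝ, E₁) g₁.inner γ s)
    (β : ℝ → M₂) (hβ : IsGeodesicOn 𝓘(ℝ, E₂) g₂.inner β s) :
    IsGeodesicOn (𝓘(ℝ, E₁).prod 𝓘(ℝ, E₂))
        (warpedMetric 𝓘(ℝ, E₁) 𝓘(ℝ, E₂) a f g₁.inner ω₁ g₂.inner η) (fun t => (γ t, β t)) s ↔
      ∀ t ∈ s,
        let X := velocity 𝓘(ℝ, E₁) γ t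
        let V := velocity 𝓘(ℝ, E₂) β t
        let F : ℝ := f (γ t)
        let XF : ℝ := mfderiv 𝓘(ℝ, E₁) 𝓘(ℝ, ℝ) f (γ t) X
        let gradf := metricGradient 𝓘(ℝ, E₁) g₁.inner f (γ t)
        let ηbar : ℝ := etaBar 𝓘(ℝ, E₁) 𝓘(ℝ, E₂) a ω₁ η (γ t, β t) (X, V)
        let φVφV : ℝ := g₂.inner (β t) (φ (β t) V) (φ (β t) V)
        let XωX : ℝ := deriv (fun τ => ω₁ (γ τ) (velocity 𝓘(ℝ, E₁) γ τ)) t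
        ((2 * a * ηbar) • J (γ t) X + (F * φVφV) • gradf = 0) ∧
        (-(2 * XF / F) • φ (β t) (φ (β t) V) +
            (2 * (-(1 / F ^ 2) * ηbar + η (β t) V)) • φ (β t) V +
            (a * (2 * a * ηbar * ω₁ (γ t) (J (γ t) X) + XωX +
              F * φVφV * ω₁ (γ t) gradf)) • ξ (β t) = 0) := by
  -- The pair is smooth because its components are, so only the acceleration equation remains, one
  -- time at a time.
  rw [IsGeodesicOn, and_iff_right (hγ.1.prodMk hβ.1)]
  refine forall₂_congr fun t ht => ?_
  have hγt (t : ℝ) (ht : t ∈ s) : ContMDiffAt 𝓘(ℝ, ℝ) 𝓘(ℝ, E₁) ∞ γ t :=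
    hγ.1.contMDiffAt (hs.mem_nhds ht)
  have hβt : ContMDiffAt 𝓘(ℝ, ℝ) 𝓘(ℝ, E₂) ∞ β t := hβ.1.contMDiffAt (hs.mem_nhds ht)
  rw [covAccel_prodMk (hγt t ht) hβt]
  exact warped_geodesic_equation_iff hM₁ hω hdω hM₂ hf hf_pos
    ((covAccel_eq (hγt t ht)).symm.trans (hγ.2 t ht)) ((covAccel_eq hβt).symm.trans (hβ.2 t ht))
    (deriv_form_velocity hω ((hs.eventually_mem ht).mono hγt)) rfl
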